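/- Let $d\ge 1$ and let $\Gamma$ be a graph with vertex set $\mathcal V$ and edge set $\mathcal E$, equipped with a free action of $\mathbb Z^d$ with finitely many orbits on vertices and on edges. A labeling of $\Gamma$ is a pair of $\mathbb Z^d$-periodic functions $V\colon\mathcal V\to\mathbb R$, $E\colon\mathcal E\to\mathbb R$; labelings form a finite-dimensional real vector space, and a property holds for generic labelings if it holds on the complement of a proper algebraic subset of this space. Let $W\subset\mathcal V$ be a set of representatives of the vertex orbits. For $z\in(\mathbb C^\times)^d$ let $H(z)$ be the $W\times W$ Floquet matrix with entries \[ H(z)_{v,u}=V(v)\,\delta_{v,u}+\sum_{a\in\mathbb Z^d:\,(v,a+u)\in\mathcal E}E(v,a+u)\,z^a , \] and put $D(z,\lambda)=\det(H(z)-\lambda)$. A critical point of the Bloch variety $\{D=0\}\subset(\mathbb C^\times)^d\times\mathbb C$ is a solution $(z,\lambda)\in(\mathbb C^\times)^d\times\mathbb C$ of the critical point equations \[ D=\frac{\partial D}{\partial z_1}=\dots=\frac{\partial D}{\partial z_d}=0 . \] For $z$ in the compact torus $\mathbb T^d=\{z : |z_i|=1\}$ the matrix $H(z)$ is hermitian;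 its ordered eigenvalues define the $|W|$ spectral band functions $\lambda_j\colon\mathbb T^d\to\mathbb R$. An extremum of the dispersion relation is a point $(z,\lambda_j(z))\in\mathbb T^d\times\mathbb R$ such that $\lambda_j$ has a local extremum at $z$. The critical point conjecture for $\Gamma$ states that, for generic labelings, the Jacobian matrix of the critical point equations (with respect to $z_1,\dots,z_d,\lambda$) is invertible at every critical point; in particular every critical point is an isolated critical point and a smooth point of the Bloch variety. The spectral edges conjecture for $\Gamma$ states that, for generic labelings, every extremum $(z,\lambda)$ of the dispersion relation is isolated among the extrema, lies on the graph of exactly one spectral band function $\lambda_j$, and is nondegenerate: $\lambda_j$ is twice continuously differentiable near $z$, its gradient vanishes at $z$, and its Hessian matrix at $z$ is invertible. Theorem. For every such $\Gamma$, if the critical point conjecture holds for $\Gamma$, then the spectral edges conjecture holds for $\Gamma$. -/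

import Mathlib

open scoped Topology ComplexConjugate

noncomputable section

namespace Floquet

/-- The relation "differ by a translation" on the edges of a graph whose vertices carry an action
of `ℤ^d`. -/
def edgeSetoid (d : ℕ) {𝒱 : Type*} [AddAction (Fin d → ℤ) 𝒱] (G : SimpleGraph 𝒱) :
    Setoid G.edgeSet where
  r e e' := ∃ a : Fin d → ℤ, e'.1 = e.1.map (fun v => a +ᵥ v)
  iseqv :=
    { refl := fun e => ⟨0, by simp⟩
      symm := by
        rintro e e' ⟨a, h⟩
        refine ⟨-a, ?_⟩
        rw [h, Sym2.map_map]
        simp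
      trans := by
        rintro e e' e'' ⟨a, h⟩ ⟨b, h'⟩
        refine ⟨b + a, ?_⟩
        rw [h', h, Sym2.map_map]
        simp [add_vadd] }

/-- A `ℤ^d`-periodic graph: a graph invariant under a free action of `ℤ^d` on its vertices, with
finitely many orbits of vertices and finitely many orbits of edges. -/
structure PeriodicGraph (d : ℕ) (𝒱 : Type*) [AddAction (Fin d → ℤ) 𝒱] where
  /-- the underlying graph -/
  graph : SimpleGraph 𝒱
  /-- `ℤ^d` acts by graph automorphisms -/
  adj_vadd : ∀ (a : Fin d → ℤ) (u v : 𝒱), graph.Adj u v → graph.Adj (a +ᵥ u) (a +ᵥ v)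
  /-- the action is free -/
  free : ∀ (a : Fin d → ℤ) (v : 𝒱), a +ᵥ v = v → a = 0
  /-- the action is cocompact -/
  finite_vertexOrbits : Finite (AddAction.orbitRel.Quotient (Fin d → ℤ) 𝒱)
  finite_edgeOrbits : Finite (Quotient (edgeSetoid d graph))

/-- `W` is a set of representatives of the `ℤ^d`-orbits of vertices. -/
def IsFundamentalDomain (d : ℕ) {𝒱 : Type*} [AddAction (Fin d → ℤ) 𝒱] (W : Finset 𝒱) : Prop :=
  ∀ v : 𝒱, ∃! w : 𝒱, w ∈ W ∧ ∃ a : Fin d → ℤ, a +ᵥ w = v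

namespace PeriodicGraph

variable {d : ℕ} {𝒱 : Type*} [AddAction (Fin d → ℤ) 𝒱] (Γ : PeriodicGraph d 𝒱)

/-- The orbits of `ℤ^d` on vertices and edges. -/
abbrev Orbits : Type _ :=
  AddAction.orbitRel.Quotient (Fin d → ℤ) 𝒱 ⊕ Quotient (edgeSetoid d Γ.graph)

/-- A labeling `(V, E)` by real periodic functions, given as a real function on orbits. -/
abbrev Labeling : Type _ := Γ.Orbits → ℝ

/-- A property of labelings holds generically: it holds on the complement of a proper algebraic
subset of the (finite-dimensional) real vector space of labelings. Every proper algebraic subset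
lies in the zero set of a single nonzero polynomial. -/
def Generic (P : Γ.Labeling → Prop) : Prop :=
  ∃ F : MvPolynomial Γ.Orbits ℝ, F ≠ 0 ∧ ∀ x : Γ.Labeling, MvPolynomial.eval x F ≠ 0 → P x

variable {Γ} (x : Γ.Labeling)

/-- The potential `V(v)`. -/
def potential (v : 𝒱) : ℝ := x (Sum.inl (Quotient.mk _ v))

open Classical in
/-- The weight `E(v,u)` if `(v,u)` is an edge, and `0` otherwise. -/
def weight (v u : 𝒱) : ℝ :=
  if h : Γ.graph.Adj v u then x (Sum.inr (Quotient.mk _ ⟨s(v, u), h⟩)) else 0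

/-- The monomial `z^a = z_1^{a_1} ⋯ z_d^{a_d}`. -/
def monomial (z : Fin d → ℂ) (a : Fin d → ℤ) : ℂ := ∏ i, z i ^ a i

/-- The Floquet matrix `H(z)`, with entry
`V(v) δ_{v,u} + ∑_{a : (v, a+u) ∈ 𝓔} E(v,a+u) z^a` in row `v` and column `u`.
The sum is finite, see `finite_translates`. -/
def floquetMatrix [DecidableEq 𝒱] (W : Finset 𝒱) (z : Fin d → ℂ) : Matrix W W ℂ :=
  Matrix.of fun v u =>
    (if v = u then (potential x v.1 : ℂ) else 0) +
      ∑ᶠ a : Fin d → ℤ, (weight x v.1 (a +ᵥ u.1) : ℂ) * monomial z a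

/-- The dispersion polynomial `D(z,λ) = det(H(z) - λ)`. -/
def dispersion [DecidableEq 𝒱] (W : Finset 𝒱) (p : (Fin d → ℂ) × ℂ) : ℂ :=
  (floquetMatrix x W p.1 - p.2 • (1 : Matrix W W ℂ)).det

/-- The coordinate directions of `ℂ^d × ℂ`: `some i` for `z_i`, and `none` for `λ`. -/
def coordDir : Option (Fin d) → (Fin d → ℂ) × ℂ
  | none => (0, 1)
  | some i => (Pi.single i 1, 0)

/-- The functions of the critical point equations: `D` and the partial derivatives
`∂D/∂z_i`. -/
def cpFun [DecidableEq 𝒱] (W : Finset 𝒱) : Option (Fin d) → (Fin d → ℂ) × ℂ → ℂ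
  | none => dispersion x W
  | some i => fun p => fderiv ℂ (dispersion x W) p (coordDir (some i))

/-- `p = (z,λ)` in `(ℂ^×)^d × ℂ` is a critical point of the Bloch variety. -/
def IsCriticalPoint [DecidableEq 𝒱] (W : Finset 𝒱) (p : (Fin d → ℂ) × ℂ) : Prop :=
  (∀ i, p.1 i ≠ 0) ∧ ∀ r, cpFun x W r p = 0

/-- The Jacobian matrix of the critical point equations. -/
def jacobian [DecidableEq 𝒱] (W : Finset 𝒱) (p : (Fin d → ℂ) × ℂ) :
    Matrix (Option (Fin d)) (Option (Fin d)) ℂ :=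
  Matrix.of fun r c => fderiv ℂ (cpFun x W r) p (coordDir c)

/-- The critical point conjecture for `Γ`: for generic labelings, the Jacobian matrix of the
critical point equations is invertible at every critical point. (At a critical point, the row of
`D` in the Jacobian is `(0, …, 0, ∂D/∂λ)`, so an invertible Jacobian forces the Bloch variety to be
smooth there, and it forces the critical point to be isolated by the inverse function theorem.) -/
def CriticalPointConjecture [DecidableEq 𝒱] (Γ : PeriodicGraph d 𝒱) (W : Finset 𝒱) : Prop :=
  Γ.Generic fun x => ∀ p, IsCriticalPoint x W p → IsUnit (jacobian x W p)

/-! ### The Floquet matrix is hermitian on the torus -/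

lemma weight_symm (v u : 𝒱) : weight x v u = weight x u v := by
  unfold weight
  by_cases h : Γ.graph.Adj v u
  · rw [dif_pos h, dif_pos h.symm]
    congr 3
    exact Subtype.ext Sym2.eq_swap
  · rw [dif_neg h, dif_neg fun h' => h h'.symm]

lemma weight_vadd (a : Fin d → ℤ) (v u : 𝒱) :
    weight x (a +ᵥ v) (a +ᵥ u) = weight x v u := by
  unfold weight
  by_cases h : Γ.graph.Adj v u
  · rw [dif_pos h, dif_pos (Γ.adj_vadd a v u h)]
    congr 2
    refine (Quotient.sound ?_).symm
    exact ⟨a, by simp⟩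
  · rw [dif_neg h, dif_neg]
    intro h'
    have := Γ.adj_vadd (-a) _ _ h'
    simp only [neg_vadd_vadd] at this
    exact h this

variable (Γ) in
lemma finite_translates (v u : 𝒱) : {a : Fin d → ℤ | Γ.graph.Adj v (a +ᵥ u)}.Finite := by
  have := Γ.finite_edgeOrbits
  have inj : ∀ a b : Fin d → ℤ, a +ᵥ u = b +ᵥ u → a = b := by
    intro a b h
    have := Γ.free (-b + a) u (by rw [add_vadd, h, neg_vadd_vadd])
    exact (neg_add_eq_zero.mp this).symm
  let f : {a : Fin d → ℤ | Γ.graph.Adj v (a +ᵥ u)} → Quotient (edgeSetoid d Γ.graph) :=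
    fun a => Quotient.mk _ ⟨s(v, a.1 +ᵥ u), a.2⟩
  have key : ∀ q ∈ (Set.univ : Set (Quotient (edgeSetoid d Γ.graph))), (f ⁻¹' {q}).Finite := by
    intro q _
    rcases (f ⁻¹' {q}).eq_empty_or_nonempty with h0 | ⟨a₀, h₀⟩
    · rw [h0]; exact Set.finite_empty
    have fib : ∀ a ∈ f ⁻¹' {q}, a.1 = a₀.1 ∨
        ∃ t : Fin d → ℤ, (t + a₀.1) +ᵥ u = v ∧ a.1 = t + t + a₀.1 := by
      intro a ha
      have hq : f a₀ = f a := by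
        rw [Set.mem_preimage, Set.mem_singleton_iff] at ha h₀
        rw [h₀, ha]
      obtain ⟨t, ht⟩ := Quotient.exact hq
      simp only [Sym2.map_mk, Sym2.eq_iff] at ht
      rcases ht with ⟨h1, h2⟩ | ⟨h1, h2⟩
      · have t0 : t = 0 := Γ.free t v h1.symm
        left
        apply inj
        rw [h2, t0, zero_vadd]
      · right
        refine ⟨t, by rw [add_vadd]; exact h1.symm, inj _ _ ?_⟩
        rw [add_assoc, add_vadd, add_vadd t a₀.1, ← h1, h2]
    by_cases hc : ∃ c : Fin d → ℤ, c +ᵥ u = v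
    · obtain ⟨c, hc⟩ := hc
      refine Set.Finite.subset (Set.Finite.preimage Subtype.val_injective.injOn
        (Set.toFinite ({a₀.1, (c - a₀.1) + (c - a₀.1) + a₀.1} : Set (Fin d → ℤ)))) ?_
      intro a ha
      rcases fib a ha with h | ⟨t, ht, h⟩
      · exact Or.inl h
      · right
        have hct : t + a₀.1 = c := inj _ _ (by rw [ht, hc])
        have : t = c - a₀.1 := by rw [← hct]; abel
        rw [Set.mem_singleton_iff, h, this]
    · refine Set.Finite.subset (Set.finite_singleton a₀) ?_
      intro a ha
      rcases fib a ha with h | ⟨t, ht, _⟩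
      · exact Subtype.ext h
      · exact absurd ⟨_, ht⟩ hc
  have h := Set.Finite.preimage' Set.finite_univ key
  rw [Set.preimage_univ, Set.finite_univ_iff] at h
  exact Set.toFinite _

lemma finite_support_entry (z : Fin d → ℂ) (v u : 𝒱) :
    (Function.support fun a : Fin d → ℤ =>
      (weight x v (a +ᵥ u) : ℂ) * monomial z a).Finite := by
  refine (finite_translates Γ v u).subset fun a ha => ?_
  by_contra h
  apply ha
  have h' : ¬ Γ.graph.Adj v (a +ᵥ u) := h
  simp [weight, h']

lemma conj_monomial (z : Fin d → Circle) (a : Fin d → ℤ) :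
    conj (monomial (fun i => (z i : ℂ)) a) = monomial (fun i => (z i : ℂ)) (-a) := by
  unfold monomial
  rw [map_prod]
  refine Finset.prod_congr rfl fun i _ => ?_
  rw [map_zpow₀, ← Circle.coe_inv_eq_conj, Circle.coe_inv, Pi.neg_apply, inv_zpow, zpow_neg]

lemma floquetMatrix_isHermitian [DecidableEq 𝒱] (W : Finset 𝒱) (z : Fin d → Circle) :
    (floquetMatrix x W fun i => (z i : ℂ)).IsHermitian := by
  refine Matrix.IsHermitian.ext fun v u => ?_
  simp only [floquetMatrix, Matrix.of_apply, star_add]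
  congr 1
  · by_cases h : v = u
    · subst h; simp
    · rw [if_neg h, if_neg fun h' => h h'.symm, star_zero]
  · change (starRingEnd ℂ).toAddMonoidHom _ = _
    rw [AddMonoidHom.map_finsum _ (finite_support_entry x _ _ _)]
    refine finsum_eq_of_bijective (fun a => -a) (Equiv.neg _).bijective fun a => ?_
    change conj _ = _
    rw [map_mul, conj_monomial, Complex.conj_ofReal]
    congr 2
    rw [weight_symm, ← weight_vadd x (-a) (a +ᵥ v.1), neg_vadd_vadd]

/-! ### Spectral band functions and their extrema -/

/-- The spectral band functions on the compact torus: the value of the `j`-th one at `z` is the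
`j`-th eigenvalue, in decreasing order and with multiplicity, of the hermitian matrix `H(z)`. -/
def band [DecidableEq 𝒱] (W : Finset 𝒱) (j : Fin (Fintype.card W)) (z : Fin d → Circle) : ℝ :=
  (floquetMatrix_isHermitian x W z).eigenvalues₀ j

/-- `(z,λ)` is an extremum of the dispersion relation: `λ` is the value at `z` of a spectral band
function that has a local extremum at `z`. -/
def IsExtremum [DecidableEq 𝒱] (W : Finset 𝒱) (p : (Fin d → Circle) × ℝ) : Prop :=
  ∃ j, band x W j p.1 = p.2 ∧ IsLocalExtr (band x W j) p.1

/-- The function `f` on the torus in the angular coordinates centred at `z`. -/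
def inAngles (f : (Fin d → Circle) → ℝ) (z : Fin d → Circle) (θ : Fin d → ℝ) : ℝ :=
  f fun i => z i * Circle.exp (θ i)

/-- The Hessian matrix at `z` of a function on the torus, in angular coordinates. -/
def hessian (f : (Fin d → Circle) → ℝ) (z : Fin d → Circle) : Matrix (Fin d) (Fin d) ℝ :=
  Matrix.of fun i j =>
    fderiv ℝ (fun θ => fderiv ℝ (inAngles f z) θ (Pi.single j 1)) 0 (Pi.single i 1)

/-- Nondegeneracy of a critical point `z` of `f`: near `z`, `f` is twice continuously
differentiable, the gradient vanishes at `z`, and the Hessian matrix at `z` is invertible. -/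
def IsNondegenerate (f : (Fin d → Circle) → ℝ) (z : Fin d → Circle) : Prop :=
  ContDiffAt ℝ 2 (inAngles f z) 0 ∧ fderiv ℝ (inAngles f z) 0 = 0 ∧ IsUnit (hessian f z)

/-- The spectral edges conjecture for `Γ`: for generic labelings, every extremum `(z,λ)` of the
dispersion relation is isolated (among the extrema), lies on the graph of exactly one spectral band
function, and is a nondegenerate critical point of that function. -/
def SpectralEdgesConjecture [DecidableEq 𝒱] (Γ : PeriodicGraph d 𝒱) (W : Finset 𝒱) : Prop :=
  Γ.Generic fun x => ∀ p, IsExtremum x W p →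
    (∀ᶠ q in 𝓝[≠] p, ¬ IsExtremum x W q) ∧
    (∃! j, band x W j p.1 = p.2) ∧
    ∀ j, band x W j p.1 = p.2 → IsNondegenerate (band x W j) p.1

end PeriodicGraph
end Floquet

end

open scoped ContDiff

noncomputable section

namespace Floquet
namespace PeriodicGraph

variable {d : ℕ} {𝒱 : Type*} [AddAction (Fin d → ℤ) 𝒱] {Γ : PeriodicGraph d 𝒱}
  (x : Γ.Labeling)

/-! ### Smoothness of the dispersion polynomial -/

/-! Fix a labeling at which every critical point has invertible Jacobian; the polynomial witnessing
genericity of these labelings also serves for the conclusion.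

Simplicity. A multiple eigenvalue of the hermitian matrix `H(z)` gives a kernel of `H(z) - λ` of
dimension at least two, so the determinant vanishes there to second order. Such a point is critical
and the row of `D` in its Jacobian is zero, a contradiction (`band_injective`).

Smoothness. A simple eigenvalue is a simple zero of `D(z, ·)`, so `∂D/∂λ ≠ 0`. Since `D` is real on
the torus, the real implicit function theorem gives smooth local roots, and their order identifies
them with the bands (`contDiffAt_band`).

Nondegeneracy. Write `b` for `λ_j` in angles. Differentiating `D(z, λ_j(z)) = 0` gives `I z_i
∂D/∂z_i + ∂D/∂λ ∂_i b = 0`, so extrema are critical points. A second differentiation there gives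
`z_i z_k ∂²D/∂z_i∂z_k = ∂D/∂λ ∂_k ∂_i b` (`jacobian_eq_hessian`), so a singular Hessian would make
the Jacobian singular. An invertible Jacobian also isolates the critical point, hence the extremum.
-/

lemma contDiffAt_zpow {n : ℕ∞ω} (m : ℤ) {z : ℂ} (hz : z ≠ 0) :
    ContDiffAt ℂ n (fun w : ℂ => w ^ m) z := by
  cases m with
  | ofNat k => simpa using contDiffAt_id.pow k
  | negSucc k =>
    simp only [zpow_negSucc]
    exact (contDiffAt_id.pow (k + 1)).inv (pow_ne_zero _ hz)

lemma contDiffAt_monomial {n : ℕ∞ω} (a : Fin d → ℤ) {z : Fin d → ℂ} (hz : ∀ i, z i ≠ 0) :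
    ContDiffAt ℂ n (fun w => monomial w a) z := by
  unfold monomial
  exact contDiffAt_prod fun i _ =>
    (contDiffAt_zpow (a i) (hz i)).comp z (contDiffAt_apply ℂ ℂ i z)

variable [DecidableEq 𝒱] (W : Finset 𝒱)

lemma contDiffAt_floquetMatrix {n : ℕ∞ω} {z : Fin d → ℂ} (hz : ∀ i, z i ≠ 0) (v u : W) :
    ContDiffAt ℂ n (fun w => floquetMatrix x W w v u) z := by
  have key : ∀ w : Fin d → ℂ, floquetMatrix x W w v u =
      (if v = u then (potential x v.1 : ℂ) else 0) +
        ∑ a ∈ (finite_translates Γ v.1 u.1).toFinset,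
          (weight x v.1 (a +ᵥ u.1) : ℂ) * monomial w a := by
    intro w
    simp only [floquetMatrix, Matrix.of_apply]
    congr 1
    refine finsum_eq_sum_of_support_subset _ fun a ha => ?_
    rw [Set.Finite.coe_toFinset]
    by_contra h
    have h' : ¬ Γ.graph.Adj v.1 (a +ᵥ u.1) := h
    exact ha (by simp [weight, h'])
  simp only [key]
  exact contDiffAt_const.add (ContDiffAt.sum fun a _ =>
    contDiffAt_const.mul (contDiffAt_monomial a hz))

/-- The matrix `H(z) - λ`. -/
def shifted (p : (Fin d → ℂ) × ℂ) : Matrix W W ℂ :=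
  floquetMatrix x W p.1 - p.2 • (1 : Matrix W W ℂ)

lemma dispersion_eq_det_shifted (p : (Fin d → ℂ) × ℂ) :
    dispersion x W p = (shifted x W p).det := rfl

lemma contDiffAt_shifted {n : ℕ∞ω} {p : (Fin d → ℂ) × ℂ} (hp : ∀ i, p.1 i ≠ 0) (v u : W) :
    ContDiffAt ℂ n (fun q => shifted x W q v u) p := by
  simp only [shifted, Matrix.sub_apply, Matrix.smul_apply, smul_eq_mul]
  exact ((contDiffAt_floquetMatrix x W hp v u).comp p contDiffAt_fst).sub
    (contDiffAt_snd.mul contDiffAt_const)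

lemma contDiffAt_dispersion {n : ℕ∞ω} {p : (Fin d → ℂ) × ℂ} (hp : ∀ i, p.1 i ≠ 0) :
    ContDiffAt ℂ n (dispersion x W) p := by
  have : dispersion x W = fun q => ∑ σ : Equiv.Perm W,
      (Equiv.Perm.sign σ : ℤ) • ∏ v, shifted x W q (σ v) v := by
    funext q
    rw [dispersion_eq_det_shifted, Matrix.det_apply]
    rfl
  rw [this]
  refine ContDiffAt.sum fun σ _ => ?_
  simp only [zsmul_eq_mul]
  exact contDiffAt_const.mul (contDiffAt_prod fun v _ => contDiffAt_shifted x W hp _ _)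

lemma differentiableAt_dispersion {p : (Fin d → ℂ) × ℂ} (hp : ∀ i, p.1 i ≠ 0) :
    DifferentiableAt ℂ (dispersion x W) p :=
  (contDiffAt_dispersion x W (n := 1) hp).differentiableAt one_ne_zero

lemma differentiableAt_fderiv_dispersion {p : (Fin d → ℂ) × ℂ} (hp : ∀ i, p.1 i ≠ 0)
    (v : (Fin d → ℂ) × ℂ) :
    DifferentiableAt ℂ (fun q => fderiv ℂ (dispersion x W) q v) p :=
  (((contDiffAt_dispersion x W (n := 2) hp).fderiv_right (m := 1) le_rfl).clm_apply
    contDiffAt_const).differentiableAt one_ne_zero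

lemma differentiableAt_cpFun {p : (Fin d → ℂ) × ℂ} (hp : ∀ i, p.1 i ≠ 0) (r : Option (Fin d)) :
    DifferentiableAt ℂ (cpFun x W r) p := by
  cases r with
  | none => exact differentiableAt_dispersion x W hp
  | some i => exact differentiableAt_fderiv_dispersion x W hp _

/-! ### The dispersion polynomial vanishes to second order at multiple eigenvalues -/

/-- If a square matrix has two linearly independent vectors in its kernel, then its determinant
vanishes after an arbitrary change of one row. -/
lemma det_updateRow_eq_zero {n : Type*} [Fintype n] [DecidableEq n] {A : Matrix n n ℂ}
    {v w : n → ℂ} (hvw : LinearIndependent ℂ ![v, w]) (hv : A.mulVec v = 0) (hw : A.mulVec w = 0)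
    (i : n) (y : n → ℂ) : (A.updateRow i y).det = 0 := by
  rw [LinearIndependent.pair_iff] at hvw
  -- The span of `v` and `w` is a plane, so it contains a nonzero vector annihilated by `y`. The
  -- other rows annihilate it too, so it lies in the kernel of the updated matrix.
  have main : ∀ s t : ℂ, (s ≠ 0 ∨ t ≠ 0) → s * (y ⬝ᵥ v) + t * (y ⬝ᵥ w) = 0 →
      (A.updateRow i y).det = 0 := by
    intro s t hst h
    refine Matrix.exists_mulVec_eq_zero_iff.mp ⟨s • v + t • w, fun h0 => ?_, ?_⟩
    · obtain ⟨hs, ht⟩ := hvw s t h0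
      tauto
    · funext k
      by_cases hk : k = i
      · subst hk
        simpa [Matrix.mulVec, Matrix.updateRow_self, dotProduct_add] using h
      · have h1 : A k ⬝ᵥ v = 0 := congrFun hv k
        have h2 : A k ⬝ᵥ w = 0 := congrFun hw k
        simp [Matrix.mulVec, Matrix.updateRow_ne hk, dotProduct_add, h1, h2]
  by_cases h : y ⬝ᵥ v = 0
  · exact main 1 0 (by simp) (by simp [h])
  · exact main (y ⬝ᵥ w) (-(y ⬝ᵥ v)) (Or.inr (neg_ne_zero.mpr h)) (by ring)

/-- The determinant as a continuous multilinear function of the rows. -/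
def detRowCMM (n : Type*) [Fintype n] [DecidableEq n] :
    ContinuousMultilinearMap ℂ (fun _ : n => n → ℂ) ℂ :=
  { (Matrix.detRowAlternating (R := ℂ) (n := n)).toMultilinearMap with
    cont := Continuous.matrix_det (A := fun M : n → n → ℂ => Matrix.of M) continuous_id }

/-- By multilinearity, the derivative of a determinant is a sum of determinants with one row
replaced, and a two-dimensional kernel kills each summand. -/
lemma fderiv_dispersion_eq_zero {p : (Fin d → ℂ) × ℂ} (hp : ∀ i, p.1 i ≠ 0) {v w : W → ℂ}
    (hvw : LinearIndependent ℂ ![v, w]) (hv : (shifted x W p).mulVec v = 0)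
    (hw : (shifted x W p).mulVec w = 0) : fderiv ℂ (dispersion x W) p = 0 := by
  have h1 : ∀ v : W, HasFDerivAt (fun q => (shifted x W q v : W → ℂ))
      (fderiv ℂ (fun q => (shifted x W q v : W → ℂ)) p) p := fun v =>
    ((contDiffAt_pi.mpr fun u => contDiffAt_shifted x W (n := 1) hp v u).differentiableAt
      one_ne_zero).hasFDerivAt
  have h2 := HasFDerivAt.multilinear_comp (detRowCMM W) h1
  have h3 : dispersion x W = fun q => detRowCMM W fun v => shifted x W q v := rfl
  rw [h3, h2.fderiv]
  refine ContinuousLinearMap.ext fun y => ?_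
  simp only [_root_.sum_apply, ContinuousLinearMap.comp_apply, zero_apply]
  refine Finset.sum_eq_zero fun k _ => ?_
  exact det_updateRow_eq_zero hvw hv hw k _

/-! ### The spectral bands and the dispersion polynomial -/

variable (d) in
/-- The point `(z, t)` of `𝕋^d × ℝ` as a point of `ℂ^d × ℂ`. -/
def toComplex (q : (Fin d → Circle) × ℝ) : (Fin d → ℂ) × ℂ := (fun i => (q.1 i : ℂ), (q.2 : ℂ))

lemma toComplex_ne_zero (q : (Fin d → Circle) × ℝ) (i : Fin d) : (toComplex d q).1 i ≠ 0 :=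
  Circle.coe_ne_zero _

lemma dispersion_eq_prod (z : Fin d → Circle) (t : ℂ) :
    dispersion x W (fun i => (z i : ℂ), t) = ∏ k, ((band x W k z : ℂ) - t) := by
  have hH := floquetMatrix_isHermitian x W z
  set H := floquetMatrix x W fun i => (z i : ℂ) with hHdef
  have h1 : H.charpoly.eval t = ∏ k, (t - (band x W k z : ℂ)) := by
    rw [hH.charpoly_eq, Polynomial.eval_prod]
    simp only [Polynomial.eval_sub, Polynomial.eval_X, Polynomial.eval_C]
    exact Fintype.prod_equiv (Fintype.equivOfCardEq (Fintype.card_fin _)).symm _ _ fun v => rfl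
  have h2 : dispersion x W (fun i => (z i : ℂ), t) = (-1) ^ Fintype.card W * H.charpoly.eval t := by
    rw [Matrix.eval_charpoly, ← Matrix.det_neg, neg_sub, dispersion]
    simp [hHdef, Matrix.smul_one_eq_diagonal, Matrix.scalar_apply]
  rw [h2, h1]
  have : ∀ k, ((band x W k z : ℂ) - t) = (-1) * (t - band x W k z) := fun k => by ring
  simp_rw [this, Finset.prod_mul_distrib]
  simp

lemma dispersion_band (z : Fin d → Circle) (j : Fin (Fintype.card W)) :
    dispersion x W (toComplex d (z, band x W j z)) = 0 := by
  refine (dispersion_eq_prod x W z _).trans (Finset.prod_eq_zero (Finset.mem_univ j) (by simp))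

lemma exists_band_eq {z : Fin d → Circle} {t : ℝ}
    (h : dispersion x W (toComplex d (z, t)) = 0) : ∃ j, band x W j z = t := by
  have := (dispersion_eq_prod x W z _).symm.trans h
  obtain ⟨j, -, hj⟩ := Finset.prod_eq_zero_iff.mp this
  exact ⟨j, by simpa [sub_eq_zero] using hj⟩

/-- Hermitian matrices have an orthonormal eigenbasis, so algebraic multiplicity yields independent
kernel vectors of `H(z) - λ`. -/
lemma fderiv_dispersion_eq_zero_of_multiple {z : Fin d → Circle} {j k : Fin (Fintype.card W)}
    (hjk : j ≠ k) (h : band x W j z = band x W k z) :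
    fderiv ℂ (dispersion x W) (toComplex d (z, band x W j z)) = 0 := by
  have hH := floquetMatrix_isHermitian x W z
  let e : Fin (Fintype.card W) ≃ W := Fintype.equivOfCardEq (Fintype.card_fin _)
  have hker : ∀ l, band x W l z = band x W j z →
      (shifted x W (toComplex d (z, band x W j z))).mulVec (hH.eigenvectorBasis (e l)).ofLp = 0 := by
    intro l hl
    have h1 := hH.mulVec_eigenvectorBasis (e l)
    have h2 : hH.eigenvalues (e l) = band x W l z := by
      simp [Matrix.IsHermitian.eigenvalues, band, e]
    rw [h2, hl] at h1
    simp only [shifted, toComplex, Matrix.sub_mulVec, Matrix.smul_mulVec, Matrix.one_mulVec]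
    rw [sub_eq_zero, h1]
    rfl
  refine fderiv_dispersion_eq_zero x W (toComplex_ne_zero _) ?_ (hker j rfl) (hker k h.symm)
  have h3 := (hH.eigenvectorBasis.toBasis.linearIndependent.comp (fun i : Fin 2 => ![e j, e k] i)
    (by
      intro a b hab
      fin_cases a <;> fin_cases b <;> simp_all [e.injective.eq_iff, eq_comm])).map'
      (WithLp.linearEquiv 2 ℂ (W → ℂ)).toLinearMap (LinearEquiv.ker _)
  convert! h3 using 1
  funext i
  fin_cases i <;> simp

/-- At a labeling for which the Jacobian is invertible at every critical point, the eigenvalues of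
the Floquet matrix are simple everywhere on the torus. -/
lemma band_injective (hx : ∀ p, IsCriticalPoint x W p → IsUnit (jacobian x W p))
    (z : Fin d → Circle) : Function.Injective fun j => band x W j z := by
  intro j k h
  by_contra hjk
  have h0 := fderiv_dispersion_eq_zero_of_multiple x W hjk h
  have hcp : IsCriticalPoint x W (toComplex d (z, band x W j z)) := by
    refine ⟨toComplex_ne_zero _, fun r => ?_⟩
    cases r with
    | none => exact dispersion_band x W z j
    | some i => simp [cpFun, h0]
  have hu := (Matrix.isUnit_iff_isUnit_det _).mp (hx _ hcp)
  rw [Matrix.det_eq_zero_of_row_eq_zero none] at hu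
  · exact not_isUnit_zero hu
  · intro c
    simp [jacobian, cpFun, h0]

lemma band_strictAnti {z : Fin d → Circle} (h : Function.Injective fun j => band x W j z) :
    StrictAnti fun j => band x W j z :=
  Antitone.strictAnti_of_injective
    (floquetMatrix_isHermitian x W z).eigenvalues₀_antitone h

/-- In `D(z,t) = ∏ (λ_k - t)` only the `j`-th factor vanishes at `t = λ_j`, so the derivative there
is `-∏_{k ≠ j} (λ_k - λ_j)`. -/
lemma fderiv_dispersion_none_ne_zero {z : Fin d → Circle}
    (h : Function.Injective fun j => band x W j z) (j : Fin (Fintype.card W)) :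
    fderiv ℂ (dispersion x W) (toComplex d (z, band x W j z)) (0, 1) ≠ 0 := by
  have h1 : HasDerivAt (fun t : ℂ => dispersion x W (fun i => (z i : ℂ), t))
      (fderiv ℂ (dispersion x W) (toComplex d (z, band x W j z)) (0, 1)) (band x W j z : ℂ) := by
    have h2 : HasDerivAt (fun t : ℂ => ((fun i => (z i : ℂ), t) : (Fin d → ℂ) × ℂ)) (0, 1)
        (band x W j z : ℂ) := (hasDerivAt_const _ _).prodMk (hasDerivAt_id _)
    have hD := (differentiableAt_dispersion x W
      (toComplex_ne_zero (z, band x W j z))).hasFDerivAt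
    exact HasFDerivAt.comp_hasDerivAt (band x W j z : ℂ) hD h2
  have h3 : HasDerivAt (fun t : ℂ => dispersion x W (fun i => (z i : ℂ), t))
      (-∏ k ∈ Finset.univ.erase j, ((band x W k z : ℂ) - band x W j z)) (band x W j z : ℂ) := by
    simp only [dispersion_eq_prod, ← Finset.mul_prod_erase Finset.univ _ (Finset.mem_univ j)]
    have h4 : HasDerivAt (fun t : ℂ => (band x W j z : ℂ) - t) (-1) (band x W j z : ℂ) :=
      (hasDerivAt_id _).const_sub _
    have h5 : DifferentiableAt ℂ (fun t : ℂ => ∏ k ∈ Finset.univ.erase j, ((band x W k z : ℂ) - t))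
        (band x W j z : ℂ) := by fun_prop
    convert! h4.mul h5.hasDerivAt using 1
    simp
  rw [h1.unique h3, neg_ne_zero, Finset.prod_ne_zero_iff]
  intro k hk
  rw [sub_ne_zero]
  exact fun hkj => (Finset.ne_of_mem_erase hk) (h (Complex.ofReal_injective hkj))

/-! ### Angular coordinates -/

/-- Angular coordinates on the torus centred at `z`. -/
def angles (z : Fin d → Circle) (θ : Fin d → ℝ) : Fin d → Circle := fun i => z i * Circle.exp (θ i)

lemma angles_zero (z : Fin d → Circle) : angles z 0 = z := by
  funext i
  simp [angles]

lemma continuous_angles (z : Fin d → Circle) : Continuous (angles z) := by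
  unfold angles
  fun_prop

/-- Angular coordinates on `𝕋^d × ℝ`, seen in `ℂ^d × ℂ`. -/
def complexAngles (z : Fin d → Circle) (u : (Fin d → ℝ) × ℝ) : (Fin d → ℂ) × ℂ :=
  toComplex d (angles z u.1, u.2)

lemma coe_angles (z : Fin d → Circle) (θ : Fin d → ℝ) (i : Fin d) :
    (angles z θ i : ℂ) = z i * Complex.exp (θ i * Complex.I) := by
  simp [angles, Circle.coe_exp]

lemma contDiff_coe_angles {n : ℕ∞ω} (z : Fin d → Circle) (i : Fin d) :
    ContDiff ℝ n fun θ => (angles z θ i : ℂ) := by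
  simp only [coe_angles]
  have : ContDiff ℝ n fun θ : Fin d → ℝ => ((θ i : ℝ) : ℂ) :=
    Complex.ofRealCLM.contDiff.comp (contDiff_apply ℝ ℝ i)
  exact contDiff_const.mul (this.mul contDiff_const).cexp

lemma contDiff_complexAngles {n : ℕ∞ω} (z : Fin d → Circle) :
    ContDiff ℝ n (complexAngles z) :=
  (contDiff_pi.mpr fun i => (contDiff_coe_angles z i).comp contDiff_fst).prodMk
    (Complex.ofRealCLM.contDiff.comp contDiff_snd)

lemma hasFDerivAt_coe_angles (z : Fin d → Circle) (θ : Fin d → ℝ) (i : Fin d) :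
    HasFDerivAt (fun θ => (angles z θ i : ℂ))
      ((Complex.I * (angles z θ i : ℂ)) •
        (Complex.ofRealCLM ∘L ContinuousLinearMap.proj (R := ℝ) (φ := fun _ : Fin d => ℝ) i)) θ := by
  simp only [coe_angles]
  have h1 : HasFDerivAt (fun θ : Fin d → ℝ => ((θ i : ℝ) : ℂ))
      (Complex.ofRealCLM ∘L ContinuousLinearMap.proj (R := ℝ) (φ := fun _ : Fin d => ℝ) i) θ :=
    (Complex.ofRealCLM ∘L
      ContinuousLinearMap.proj (R := ℝ) (φ := fun _ : Fin d => ℝ) i).hasFDerivAt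
  have h2 := ((h1.mul_const Complex.I).cexp).const_mul (z i : ℂ)
  refine h2.congr_fderiv (ContinuousLinearMap.ext fun v => ?_)
  simp
  ring

/-- The derivative of the graph of a function `b` over the torus, in the direction of an angular
coordinate. -/
lemma hasFDerivAt_graph (z : Fin d → Circle) {b : (Fin d → ℝ) → ℝ} {θ : Fin d → ℝ}
    (hb : DifferentiableAt ℝ b θ) :
    ∃ L : (Fin d → ℝ) →L[ℝ] (Fin d → ℂ) × ℂ,
      HasFDerivAt (fun θ => complexAngles z (θ, b θ)) L θ ∧
      ∀ i, L (Pi.single i 1) = (Complex.I * (angles z θ i : ℂ)) • coordDir (some i) +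
        (fderiv ℝ b θ (Pi.single i 1) : ℂ) • coordDir none := by
  refine ⟨_, (hasFDerivAt_pi.mpr fun i => hasFDerivAt_coe_angles z θ i).prodMk
    (Complex.ofRealCLM.hasFDerivAt.comp θ hb.hasFDerivAt), fun i => ?_⟩
  ext k
  · by_cases h : k = i
    · subst h; simp [coordDir]
    · simp [coordDir, h]
  · simp [coordDir]

/-! ### Smoothness of the bands -/

/-- The dispersion polynomial in real coordinates. -/
def realDispersion (z : Fin d → Circle) (u : (Fin d → ℝ) × ℝ) : ℝ :=
  (dispersion x W (complexAngles z u)).re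

/-- All factors `λ_k - t` are real over the torus, so taking the real part in `realDispersion` loses
nothing. -/
lemma dispersion_complexAngles (z : Fin d → Circle) (u : (Fin d → ℝ) × ℝ) :
    dispersion x W (complexAngles z u) = (realDispersion x W z u : ℂ) := by
  have : dispersion x W (complexAngles z u) =
      ((∏ k, (band x W k (angles z u.1) - u.2) : ℝ) : ℂ) := by
    refine (dispersion_eq_prod x W (angles z u.1) _).trans ?_
    push_cast
    rfl
  rw [realDispersion, this, Complex.ofReal_re]

lemma contDiffAt_realDispersion {n : ℕ∞ω} (z : Fin d → Circle) (u : (Fin d → ℝ) × ℝ) :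
    ContDiffAt ℝ n (realDispersion x W z) u :=
  have hD : ContDiffAt ℝ n (dispersion x W) (complexAngles z u) :=
    (contDiffAt_dispersion x W (toComplex_ne_zero (angles z u.1, u.2))).restrict_scalars ℝ
  Complex.reCLM.contDiff.contDiffAt.comp u (hD.comp u (contDiff_complexAngles z).contDiffAt)

lemma fderiv_realDispersion_ne_zero {z : Fin d → Circle}
    (h : Function.Injective fun j => band x W j z) (j : Fin (Fintype.card W)) :
    fderiv ℝ (realDispersion x W z) (0, band x W j z) (0, 1) ≠ 0 := by
  intro h0
  apply fderiv_dispersion_none_ne_zero x W h j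
  set t := band x W j z
  have hc : HasDerivAt (fun s : ℝ => ((0, s) : (Fin d → ℝ) × ℝ)) (0, 1) t :=
    (hasDerivAt_const _ _).prodMk (hasDerivAt_id _)
  have h1 : HasDerivAt (fun s : ℝ => (realDispersion x W z (0, s) : ℂ)) 0 t := by
    have hD := ((contDiffAt_realDispersion x W (n := 1) z (0, t)).differentiableAt
      one_ne_zero).hasFDerivAt.comp_hasDerivAt t hc
    rw [h0] at hD
    exact_mod_cast hD.ofReal_comp
  have h2 : HasDerivAt (fun s : ℝ => complexAngles z (0, s)) (0, 1) t := by
    simp only [complexAngles, toComplex]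
    exact (hasDerivAt_const _ _).prodMk (hasDerivAt_id t).ofReal_comp
  have hz : complexAngles z (0, t) = toComplex d (z, t) := by
    simp [complexAngles, angles_zero]
  have hD := ((differentiableAt_dispersion x W
    (toComplex_ne_zero (angles z 0, t))).hasFDerivAt.restrictScalars ℝ)
  have h3 := HasFDerivAt.comp_hasDerivAt t (f := fun s : ℝ => complexAngles z (0, s)) hD h2
  have h4 := h3.congr_of_eventuallyEq
    (f₁ := fun s : ℝ => (realDispersion x W z (0, s) : ℂ))
    (Filter.Eventually.of_forall fun s => (dispersion_complexAngles x W z (0, s)).symm)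
  rw [← h4.unique h1, angles_zero]
  rfl

/-- The implicit function theorem yields a smooth eigenvalue through `λ_j(z)`. Which band it follows
is not yet determined: `k` may depend on `θ`. -/
lemma exists_contDiffAt_root {z : Fin d → Circle}
    (h : Function.Injective fun j => band x W j z) (j : Fin (Fintype.card W)) :
    ∃ φ : (Fin d → ℝ) → ℝ, ContDiffAt ℝ 2 φ 0 ∧ φ 0 = band x W j z ∧
      ∀ᶠ θ in 𝓝 0, ∃ k, band x W k (angles z θ) = φ θ := by
  have cd := contDiffAt_realDispersion x W (n := 2) z (0, band x W j z)
  have hinv : (fderiv ℝ (realDispersion x W z) (0, band x W j z) ∘L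
      ContinuousLinearMap.inr ℝ (Fin d → ℝ) ℝ).IsInvertible := by
    refine ⟨ContinuousLinearEquiv.unitsEquivAut ℝ
      (Units.mk0 _ (fderiv_realDispersion_ne_zero x W h j)), ?_⟩
    ext
    simp
  refine ⟨cd.implicitFunction two_ne_zero hinv,
    cd.contDiffAt_implicitFunction two_ne_zero hinv,
    cd.implicitFunction_apply_self two_ne_zero hinv, ?_⟩
  filter_upwards [cd.eventually_apply_implicitFunction two_ne_zero hinv] with θ hθ
  apply exists_band_eq
  have h0 : realDispersion x W z (0, band x W j z) = 0 := by
    rw [realDispersion, complexAngles, angles_zero, dispersion_band, Complex.zero_re]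
  have h1 := dispersion_complexAngles x W z (θ, cd.implicitFunction two_ne_zero hinv θ)
  rw [hθ, h0, Complex.ofReal_zero] at h1
  exact h1

/-- Where the eigenvalues are simple, the spectral bands are smooth. -/
lemma contDiffAt_band {z : Fin d → Circle}
    (h : Function.Injective fun j => band x W j z) (j : Fin (Fintype.card W)) :
    ContDiffAt ℝ 2 (inAngles (band x W j) z) 0 := by
  -- There are as many local roots as bands, and by continuity they stay strictly ordered near `0`.
  choose φ hφ hφ0 hφe using exists_contDiffAt_root x W h
  have hlt : ∀ᶠ θ in 𝓝 (0 : Fin d → ℝ), StrictAnti fun k => φ k θ := by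
    simp only [StrictAnti, Filter.eventually_all]
    intro k l hkl
    refine (hφ l).continuousAt.eventually_lt (hφ k).continuousAt ?_
    rw [hφ0, hφ0]
    exact band_strictAnti x W h hkl
  refine (hφ j).congr_of_eventuallyEq ?_
  filter_upwards [hlt, Filter.eventually_all.mpr hφe] with θ hanti hroot
  choose σ hσ using hroot
  have hmono : StrictMono σ := by
    intro k l hkl
    by_contra hle
    have := (floquetMatrix_isHermitian x W (angles z θ)).eigenvalues₀_antitone (not_lt.mp hle)
    change band x W (σ k) (angles z θ) ≤ band x W (σ l) (angles z θ) at this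
    rw [hσ, hσ] at this
    exact (hanti hkl).not_ge this
  -- A strictly increasing self-map of a finite chain is an order automorphism, and a well-order has
  -- only the trivial one.
  have hid : σ = id := by
    have hbij : Function.Bijective σ := Finite.injective_iff_bijective.mp hmono.injective
    have := Subsingleton.elim (hmono.orderIsoOfSurjective σ hbij.2) (OrderIso.refl _)
    funext k
    exact congrArg (fun e : Fin (Fintype.card W) ≃o Fin (Fintype.card W) => e k) this
  have := hσ j
  rw [hid] at this
  exact this

/-! ### Extrema are critical points -/

/-- The chain rule for the equation `D(z, λ_j(z)) = 0`. -/
lemma cpFun_graph {z : Fin d → Circle} (j : Fin (Fintype.card W)) {θ : Fin d → ℝ}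
    (hb : DifferentiableAt ℝ (inAngles (band x W j) z) θ) (i : Fin d) :
    cpFun x W (some i) (complexAngles z (θ, inAngles (band x W j) z θ)) *
        (Complex.I * (angles z θ i : ℂ)) +
      fderiv ℂ (dispersion x W) (complexAngles z (θ, inAngles (band x W j) z θ)) (coordDir none) *
        (fderiv ℝ (inAngles (band x W j) z) θ (Pi.single i 1) : ℂ) = 0 := by
  obtain ⟨L, hL, hLi⟩ := hasFDerivAt_graph z hb
  have hD := ((differentiableAt_dispersion x W (toComplex_ne_zero
    (angles z θ, inAngles (band x W j) z θ))).hasFDerivAt.restrictScalars ℝ)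
  have h1 := HasFDerivAt.comp θ (f := fun θ => complexAngles z (θ, inAngles (band x W j) z θ)) hD hL
  have h2 := h1.congr_of_eventuallyEq (f₁ := fun _ => (0 : ℂ))
    (Filter.Eventually.of_forall fun θ => (dispersion_band x W (angles z θ) j).symm)
  have h3 := congrArg (fun M => M (Pi.single i 1)) (h2.unique (hasFDerivAt_const 0 θ))
  simp only [ContinuousLinearMap.comp_apply, hLi, map_add, zero_apply,
    ContinuousLinearMap.coe_restrictScalars', map_smul, smul_eq_mul] at h3
  rw [← h3, mul_comm, mul_comm (fderiv ℂ _ _ (coordDir none))]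
  rfl

lemma complexAngles_graph_zero (z : Fin d → Circle) (f : (Fin d → Circle) → ℝ) :
    complexAngles z (0, inAngles f z 0) = toComplex d (z, f z) := by
  have : inAngles f z 0 = f z := congrArg f (angles_zero z)
  rw [this, complexAngles, angles_zero]

/-- Fermat's theorem; differentiability is not assumed, because `fderiv` is zero by default where it
fails. -/
lemma fderiv_inAngles_eq_zero {f : (Fin d → Circle) → ℝ} {z : Fin d → Circle}
    (h : IsLocalExtr f z) : fderiv ℝ (inAngles f z) 0 = 0 := by
  refine IsLocalExtr.fderiv_eq_zero ?_
  have hc : Filter.Tendsto (angles z) (𝓝 0) (𝓝 z) := by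
    simpa only [angles_zero] using (continuous_angles z).tendsto 0
  have h0 : inAngles f z 0 = f z := congrArg f (angles_zero z)
  refine h.imp (fun h => ?_) fun h => ?_
  · exact (hc.eventually h).mono fun θ hθ => h0.trans_le hθ
  · exact (hc.eventually h).mono fun θ hθ => hθ.trans_eq h0.symm

lemma isCriticalPoint_of_fderiv_eq_zero {z : Fin d → Circle} {j : Fin (Fintype.card W)}
    (hb : ContDiffAt ℝ 2 (inAngles (band x W j) z) 0)
    (h0 : fderiv ℝ (inAngles (band x W j) z) 0 = 0) :
    IsCriticalPoint x W (toComplex d (z, band x W j z)) := by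
  refine ⟨toComplex_ne_zero _, fun r => ?_⟩
  cases r with
  | none => exact dispersion_band x W z j
  | some i =>
    have h1 := cpFun_graph x W j (hb.differentiableAt two_ne_zero) i
    rw [h0, complexAngles_graph_zero] at h1
    simpa [angles_zero] using h1

/-! ### The Hessian matrix -/

/-- The Hessian matrix of a band at a critical point is expressed by the Jacobian matrix of the
critical point equations. -/
lemma jacobian_eq_hessian {z : Fin d → Circle} {j : Fin (Fintype.card W)}
    (hb : ContDiffAt ℝ 2 (inAngles (band x W j) z) 0)
    (h0 : fderiv ℝ (inAngles (band x W j) z) 0 = 0) (i k : Fin d) :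
    (z i : ℂ) * z k * jacobian x W (toComplex d (z, band x W j z)) (some i) (some k) =
      fderiv ℂ (dispersion x W) (toComplex d (z, band x W j z)) (coordDir none) *
        (hessian (band x W j) z k i : ℂ) := by
  set b := inAngles (band x W j) z
  have hbe : ∀ᶠ θ in 𝓝 (0 : Fin d → ℝ), DifferentiableAt ℝ b θ :=
    (hb.eventually (by simp)).mono fun θ hθ => hθ.differentiableAt two_ne_zero
  obtain ⟨L, hL, hLi⟩ := hasFDerivAt_graph z (hb.differentiableAt two_ne_zero)
  have hp : complexAngles z (0, band x W j z) = toComplex d (z, band x W j z) := by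
    rw [complexAngles, angles_zero]
  have hA := HasFDerivAt.comp (0 : Fin d → ℝ) (f := fun θ => complexAngles z (θ, b θ))
    ((differentiableAt_cpFun x W (toComplex_ne_zero (angles z 0, b 0))
      (some i)).hasFDerivAt.restrictScalars ℝ) hL
  have hC := HasFDerivAt.comp (0 : Fin d → ℝ) (f := fun θ => complexAngles z (θ, b θ))
    ((differentiableAt_fderiv_dispersion x W (toComplex_ne_zero (angles z 0, b 0))
      (coordDir none)).hasFDerivAt.restrictScalars ℝ) hL
  have hB := (hasFDerivAt_coe_angles z 0 i).const_mul Complex.I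
  have hE : HasFDerivAt (fun θ => (fderiv ℝ b θ (Pi.single i 1) : ℂ))
      (Complex.ofRealCLM ∘L fderiv ℝ (fun θ => fderiv ℝ b θ (Pi.single i 1)) 0) 0 :=
    Complex.ofRealCLM.hasFDerivAt.comp 0
      (((hb.fderiv_right (m := 1) le_rfl).clm_apply contDiffAt_const).differentiableAt
        one_ne_zero).hasFDerivAt
  -- The first-order identity `cpFun_graph` holds on a whole neighbourhood of `0`, so it can be
  -- differentiated again by the product rule.
  have hsum := ((hA.mul hB).add (hC.mul hE)).congr_of_eventuallyEq (f₁ := fun _ => (0 : ℂ))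
    (hbe.mono fun θ hθ => (cpFun_graph x W j hθ i).symm)
  have hcp := (isCriticalPoint_of_fderiv_eq_zero x W hb h0).2 (some i)
  have h1 := congrArg (fun M => M (Pi.single k 1)) (hsum.unique (hasFDerivAt_const 0 _))
  have hb0 : b 0 = band x W j z := congrArg (band x W j) (angles_zero z)
  -- The terms with an undifferentiated `∂D/∂z_i` or band gradient vanish at `0`. The two remaining
  -- factors `I` supply the sign.
  simp only [Function.comp_apply, hp, hb0, hcp, h0, angles_zero, add_apply, smul_apply,
    ContinuousLinearMap.comp_apply, hLi, zero_apply,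
    ContinuousLinearMap.coe_restrictScalars', map_smul, smul_eq_mul, zero_mul, zero_smul,
    zero_add, add_zero, Complex.ofReal_zero, Complex.ofRealCLM_apply] at h1
  have hI := Complex.I_mul_I
  simp only [jacobian, hessian, Matrix.of_apply]
  linear_combination -h1 + (z i : ℂ) * z k *
    fderiv ℂ (cpFun x W (some i)) (toComplex d (z, band x W j z)) (coordDir (some k)) * hI

lemma isUnit_hessian {z : Fin d → Circle} {j : Fin (Fintype.card W)}
    (hb : ContDiffAt ℝ 2 (inAngles (band x W j) z) 0)
    (h0 : fderiv ℝ (inAngles (band x W j) z) 0 = 0)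
    (hJ : IsUnit (jacobian x W (toComplex d (z, band x W j z)))) :
    IsUnit (hessian (band x W j) z) := by
  have hcp := isCriticalPoint_of_fderiv_eq_zero x W hb h0
  rw [Matrix.isUnit_iff_isUnit_det, isUnit_iff_ne_zero] at hJ ⊢
  contrapose! hJ
  obtain ⟨v, hv0, hv⟩ := Matrix.exists_vecMul_eq_zero_iff.mpr hJ
  -- Rescaling a left null vector `v` of the Hessian by `z_k` absorbs the factor in
  -- `jacobian_eq_hessian`. The zero `λ`-component removes the `λ`-column, about which nothing is
  -- known.
  refine Matrix.exists_mulVec_eq_zero_iff.mp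
    ⟨fun r => r.elim 0 fun k => (z k : ℂ) * v k, fun h => hv0 ?_, ?_⟩
  · funext k
    simpa using congrFun h (some k)
  · funext r
    simp only [Matrix.mulVec, dotProduct, Fintype.sum_option, Option.elim, mul_zero, zero_add,
      Pi.zero_apply]
    cases r with
    | none =>
      refine Finset.sum_eq_zero fun k _ => ?_
      have : jacobian x W (toComplex d (z, band x W j z)) none (some k) = 0 := hcp.2 (some k)
      rw [this, zero_mul]
    | some i =>
      refine (mul_eq_zero.mp ?_).resolve_left (Circle.coe_ne_zero (z i))
      rw [Finset.mul_sum]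
      have h1 : ∑ k, v k * hessian (band x W j) z k i = 0 := congrFun hv i
      calc _ = fderiv ℂ (dispersion x W) (toComplex d (z, band x W j z)) (coordDir none) *
            ((∑ k, v k * hessian (band x W j) z k i : ℝ) : ℂ) := by
            push_cast
            rw [Finset.mul_sum]
            refine Finset.sum_congr rfl fun k _ => ?_
            linear_combination (v k : ℂ) * jacobian_eq_hessian x W hb h0 i k
        _ = 0 := by rw [h1, Complex.ofReal_zero, mul_zero]

/-! ### Critical points are isolated -/

/-- An invertible Jacobian makes the derivative of the equations injective, hence bounded below in
finite dimension. The equations then cannot vanish at nearby points other than `p`. -/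
lemma eventually_not_isCriticalPoint {p : (Fin d → ℂ) × ℂ} (hp : ∀ i, p.1 i ≠ 0)
    (hJ : IsUnit (jacobian x W p)) : ∀ᶠ q in 𝓝[≠] p, ¬ IsCriticalPoint x W q := by
  have hF : HasFDerivAt (fun q r => cpFun x W r q)
      (ContinuousLinearMap.pi fun r => fderiv ℂ (cpFun x W r) p) p :=
    hasFDerivAt_pi.mpr fun r => (differentiableAt_cpFun x W hp r).hasFDerivAt
  have hcoord : ∀ y : (Fin d → ℂ) × ℂ,
      y = y.2 • coordDir none + ∑ i, y.1 i • coordDir (some i) := by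
    intro y
    ext k
    · simp [coordDir, Prod.fst_sum, Finset.sum_apply, Pi.single_apply]
    · simp [coordDir, Prod.snd_sum]
  have hker : LinearMap.ker (ContinuousLinearMap.pi fun r =>
      fderiv ℂ (cpFun x W r) p).toLinearMap = ⊥ := by
    rw [LinearMap.ker_eq_bot']
    intro y hy
    have h1 : (jacobian x W p).mulVec (fun r => r.elim y.2 y.1) = 0 := by
      funext r
      have h2 : fderiv ℂ (cpFun x W r) p y = 0 := congrFun hy r
      rw [hcoord y] at h2
      simp only [Matrix.mulVec, dotProduct, Fintype.sum_option, Option.elim, jacobian,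
        Matrix.of_apply, Pi.zero_apply]
      simpa [mul_comm] using h2
    have h3 : (fun r : Option (Fin d) => r.elim y.2 y.1) = 0 :=
      Matrix.mulVec_injective_of_isUnit hJ (h1.trans (Matrix.mulVec_zero _).symm)
    ext k
    · exact congrFun h3 (some k)
    · exact congrFun h3 none
  obtain ⟨K, -, hK⟩ := LinearMap.exists_antilipschitzWith _ hker
  filter_upwards [hF.eventually_ne (c := 0) ⟨K, hK⟩] with q hq hcp
  exact hq (funext fun r => hcp.2 r)

/-- Injectivity of the embedding preserves punctured neighbourhoods, which transfers isolation from
critical points to extrema. -/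
lemma tendsto_toComplex (p : (Fin d → Circle) × ℝ) :
    Filter.Tendsto (toComplex d) (𝓝[≠] p) (𝓝[≠] (toComplex d p)) := by
  have hc : Continuous (toComplex d) := by
    unfold toComplex
    fun_prop
  refine tendsto_nhdsWithin_of_tendsto_nhds_of_eventually_within _
    (hc.continuousAt.tendsto.mono_left nhdsWithin_le_nhds) ?_
  filter_upwards [self_mem_nhdsWithin] with q hq heq
  refine hq (Prod.ext (funext fun i => ?_) ?_)
  · exact Circle.coe_injective (congrFun (congrArg Prod.fst heq) i)
  · exact Complex.ofReal_injective (congrArg Prod.snd heq)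

variable (Γ) in
/-- For every periodic graph, the critical point conjecture implies the spectral edges
conjecture. -/
theorem CriticalPointConjecture.spectralEdgesConjecture
    (hCPC : Γ.CriticalPointConjecture W) : Γ.SpectralEdgesConjecture W := by
  obtain ⟨F, hF, hgood⟩ := hCPC
  refine ⟨F, hF, fun x hxF => ?_⟩
  have hx := hgood x hxF
  have hinj := band_injective x W hx
  have hcp : ∀ p, IsExtremum x W p → IsCriticalPoint x W (toComplex d p) := by
    rintro ⟨z, t⟩ ⟨j, hj, hext⟩
    obtain rfl : band x W j z = t := hj
    exact isCriticalPoint_of_fderiv_eq_zero x W (contDiffAt_band x W (hinj z) j)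
      (fderiv_inAngles_eq_zero hext)
  intro p hp
  refine ⟨?_, ?_, fun k hk => ?_⟩
  · have h1 := (tendsto_toComplex p).eventually
      (eventually_not_isCriticalPoint x W (toComplex_ne_zero p) (hx _ (hcp p hp)))
    exact h1.mono fun q hq hqe => hq (hcp q hqe)
  · obtain ⟨j, hj, -⟩ := hp
    exact ⟨j, hj, fun k hk => hinj p.1 (hk.trans hj.symm)⟩
  · have hJ := hx _ (hcp p hp)
    obtain ⟨z, t⟩ := p
    obtain ⟨j, hj, hext⟩ := hp
    obtain rfl : k = j := hinj z (hk.trans hj.symm)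
    obtain rfl : band x W k z = t := hk
    have hb := contDiffAt_band x W (hinj z) k
    have h0 := fderiv_inAngles_eq_zero hext
    exact ⟨hb, h0, isUnit_hessian x W hb h0 hJ⟩

end PeriodicGraph
end Floquet
end

theorem mainTheorem8 {d : ℕ} (hd : 0 < d) {𝒱 : Type*} [AddAction (Fin d → ℤ) 𝒱] [DecidableEq 𝒱]
    (Γ : Floquet.PeriodicGraph d 𝒱) (W : Finset 𝒱) (hW : Floquet.IsFundamentalDomain d W)
    (hCPC : Γ.CriticalPointConjecture W) : Γ.SpectralEdgesConjecture W :=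
  Floquet.PeriodicGraph.CriticalPointConjecture.spectralEdgesConjecture Γ W hCPC
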